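/- Let $X$ be a real Banach space, let $T(t)$, $t\ge 0$, be a $C_0$ semigroup on $X$ with generator $A$ and domain $\mathcal{D}_A$, let $V$ be a real Hilbert space (identified with its dual), and let $C:X\to V$ be a bounded linear operator. Reflexivity of $X$ is not assumed. Notation. $\mathcal{B}_s(X,X^*)$ is the Banach space, with the operator norm, of bounded operators $P:X\to X^*$ that are symmetric, i.e. $\langle Px,y\rangle=\langle Py,x\rangle$ for all $x,y\in X$; such a $P$ is called positive definite, $P\in\mathcal{B}_s^+(X,X^*)$, if $\langle Px,x\rangle\ge 0$ for all $x\in X$. $A^*$ is the Banach space adjoint of $A$, with domain $\mathcal{D}_{A^*}\subseteq X^*$. The Lyapunov generator $\mathcal{L}_A$ is the weak* generator of the semigroup $P\mapsto T(t)^*PT(t)$ on $\mathcal{B}_s(X,X^*)$: $P\in\mathcal{D}_{\mathcal{L}_A}$ and $\mathcal{L}_AP=Q$ if and only if $\frac1h\bigl(T(h)^*PT(h)-P\bigr)\to Q$ as $h\to 0^+$ in the topology given by the functionals $R\mapsto\sum_{i}\langle Rx_i,y_i\rangle$ with $x_i,y_i\in X$, $\sum_i\|x_i\|^2<\infty$,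 $\sum_i\|y_i\|^2<\infty$. A $C_0$ semigroup $S(t)$ is exponentially stable if $\|S(t)\|\le Me^{-\omega t}$ for all $t\ge 0$ with some constants $M$ and $\omega>0$. The pair $(C,A)$ is called exponentially detectable if there is a bounded operator $L:V\to X$ such that $A-LC$ (with domain $\mathcal{D}_A$) generates an exponentially stable $C_0$ semigroup. It is called detectable in $L^2$ if for every $x\in X$ $$\int_0^\infty\|CT(t)x\|^2\,dt<\infty\implies\int_0^\infty\|T(t)x\|^2\,dt<\infty.$$ Theorem. If $(C,A)$ is exponentially detectable, then the following conditions are equivalent: (i) the equation $A^*P+PA=-C^*C$ (on $\mathcal{D}_A$) has a positive definite solution $P\in\mathcal{B}_s^+(X,X^*)$ such that $P(\mathcal{D}_A)\subseteq\mathcal{D}_{A^*}$; (ii) $T(t)$ is exponentially stable; (iii) the Lyapunov generator $\mathcal{L}_A$ has a bounded inverse on $\mathcal{B}_s(X,X^*)$ and $-\mathcal{L}_A^{-1}\ge 0$, i.e. $-\mathcal{L}_A^{-1}$ maps $\mathcal{B}_s^+(X,X^*)$ into itself. Moreover, the equivalence of (i)-(iii) holds already if $(C,A)$ is detectable in $L^2$,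 and this is a weaker condition: exponential detectability of $(C,A)$ implies its detectability in $L^2$. -/

import Mathlib

open Filter Topology MeasureTheory

noncomputable section

/-- A `C₀` (strongly continuous one-parameter) semigroup of bounded operators on a real normed
space. Only the values at times `t ≥ 0` are meaningful. -/
structure C0Semigroup (X : Type*) [NormedAddCommGroup X] [NormedSpace ℝ X] where
  /-- The operator `T(t)`. -/
  op : ℝ → X →L[ℝ] X
  op_zero : op 0 = ContinuousLinearMap.id ℝ X
  op_add : ∀ s t : ℝ, 0 ≤ s → 0 ≤ t → op (s + t) = (op s).comp (op t)
  continuousOn_orbit : ∀ x : X, ContinuousOn (fun t => op t x) (Set.Ici 0)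

namespace C0Semigroup

variable {X : Type*} [NormedAddCommGroup X] [NormedSpace ℝ X]

/-- The graph of the infinitesimal generator: the pairs `(x, y)` such that
`(T(h) x - x) / h → y` in norm as `h → 0+`. -/
def generatorGraph (T : C0Semigroup X) : Submodule ℝ (X × X) where
  carrier := {p | Tendsto (fun h : ℝ => h⁻¹ • (T.op h p.1 - p.1)) (𝓝[>] 0) (𝓝 p.2)}
  zero_mem' := by simp
  add_mem' := by
    intro p q hp hq
    refine (Tendsto.add hp hq).congr fun h => ?_
    simp only [Prod.fst_add, map_add, ← smul_add]
    congr 1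
    abel
  smul_mem' := by
    intro c p hp
    refine (Tendsto.const_smul hp c).congr fun h => ?_
    simp only [Prod.smul_fst, map_smul, ← smul_sub, smul_comm c]

/-- The infinitesimal generator `A` of a `C₀` semigroup, an unbounded operator with domain
`D_A`. -/
def generator (T : C0Semigroup X) : X →ₗ.[ℝ] X := T.generatorGraph.toLinearPMap

theorem mem_graph_generator (T : C0Semigroup X) (x y : X) :
    (x, y) ∈ T.generator.graph ↔
      Tendsto (fun h : ℝ => h⁻¹ • (T.op h x - x)) (𝓝[>] 0) (𝓝 y) := by
  rw [generator, Submodule.toLinearPMap_graph_eq]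
  · exact Iff.rfl
  · rintro ⟨a, b⟩ hp (rfl : a = 0)
    refine tendsto_nhds_unique hp ?_
    simp

/-- Exponential stability: `‖T(t)‖ ≤ M exp (-ω t)` for all `t ≥ 0`, with some `ω > 0`. -/
def IsExponentiallyStable (T : C0Semigroup X) : Prop :=
  ∃ M ω : ℝ, 0 < ω ∧ ∀ t : ℝ, 0 ≤ t → ‖T.op t‖ ≤ M * Real.exp (-(ω * t))

end C0Semigroup

section Adjoint

variable {X : Type*} [NormedAddCommGroup X] [NormedSpace ℝ X]

/-- The graph of the Banach space adjoint of `A`: the pairs `(f, g)` of functionals with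
`⟨f, A x⟩ = ⟨g, x⟩` for all `x` in the domain of `A`. -/
def banachAdjointGraph (A : X →ₗ.[ℝ] X) : Submodule ℝ (StrongDual ℝ X × StrongDual ℝ X) where
  carrier := {p | ∀ x : A.domain, p.1 (A x) = p.2 (x : X)}
  zero_mem' := by intro x; simp
  add_mem' := by
    intro p q hp hq x
    simp [hp x, hq x]
  smul_mem' := by
    intro c p hp x
    simp [hp x]

/-- The Banach space adjoint `A*` of a densely defined operator `A`, with domain `D_{A*}`
consisting of the functionals `f` for which `x ↦ ⟨f, A x⟩` is bounded on the domain of `A`. -/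
def banachAdjoint (A : X →ₗ.[ℝ] X) : StrongDual ℝ X →ₗ.[ℝ] StrongDual ℝ X :=
  (banachAdjointGraph A).toLinearPMap

theorem mem_graph_banachAdjoint (A : X →ₗ.[ℝ] X) (hA : Dense (A.domain : Set X))
    (f g : StrongDual ℝ X) :
    (f, g) ∈ (banachAdjoint A).graph ↔ ∀ x : A.domain, f (A x) = g (x : X) := by
  rw [banachAdjoint, Submodule.toLinearPMap_graph_eq]
  · exact Iff.rfl
  · rintro ⟨a, b⟩ hp (rfl : a = 0)
    have h : (b : X → ℝ) = fun _ => 0 :=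
      Continuous.ext_on hA b.continuous continuous_const fun x hx => (hp ⟨x, hx⟩).symm
    ext x
    exact congrFun h x

end Adjoint

section Symmetric

/-- Linear subspaces of a real normed space `E` (this only fixes the instances on `E` that are
used, those of the normed structure). -/
abbrev NormedSubspace (E : Type*) [NormedAddCommGroup E] [NormedSpace ℝ E] := Submodule ℝ E

variable (X : Type*) [NormedAddCommGroup X] [NormedSpace ℝ X]

/-- The subspace of symmetric operators in the space `B(X, X*)` of bounded operators from `X` to
its dual. -/
def symSubspace : NormedSubspace (X →L[ℝ] StrongDual ℝ X) where
  carrier := {P | ∀ x y : X, P x y = P y x}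
  zero_mem' := by intro x y; simp
  add_mem' := by
    intro P Q hP hQ x y
    simp [hP x y, hQ x y]
  smul_mem' := by
    intro c P hP x y
    simp [hP x y]

/-- The space `B_s(X, X*)` of bounded symmetric operators from `X` to its dual, with the operator
norm. -/
def SymOp : Type _ := symSubspace X

instance : NormedAddCommGroup (SymOp X) := inferInstanceAs (NormedAddCommGroup (symSubspace X))

instance : NormedSpace ℝ (SymOp X) := inferInstanceAs (NormedSpace ℝ (symSubspace X))

instance : CoeOut (SymOp X) (X →L[ℝ] StrongDual ℝ X) := ⟨Subtype.val⟩

variable {X}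

theorem SymOp.coe_add (P Q : SymOp X) :
    ((P + Q : SymOp X) : X →L[ℝ] StrongDual ℝ X) = (P : X →L[ℝ] StrongDual ℝ X) + Q := rfl

theorem SymOp.coe_smul (c : ℝ) (P : SymOp X) :
    ((c • P : SymOp X) : X →L[ℝ] StrongDual ℝ X) = c • (P : X →L[ℝ] StrongDual ℝ X) := rfl

theorem SymOp.norm_coe (P : SymOp X) : ‖(P : X →L[ℝ] StrongDual ℝ X)‖ = ‖P‖ := rfl

theorem SymOp.coe_injective {P Q : SymOp X}
    (h : (P : X →L[ℝ] StrongDual ℝ X) = (Q : X →L[ℝ] StrongDual ℝ X)) : P = Q := Subtype.ext h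

/-- Positive definiteness (with a non-strict inequality): `⟨P x, x⟩ ≥ 0` for all `x`. -/
def IsPosDef (P : X →L[ℝ] StrongDual ℝ X) : Prop := ∀ x : X, 0 ≤ P x x

/-- The ultraweak* functional `P ↦ ∑ i, ⟨P (x i), y i⟩` on `B(X, X*)`. -/
def uwPairing (x y : ℕ → X) (P : X →L[ℝ] StrongDual ℝ X) : ℝ := ∑' i, P (x i) (y i)

/-- Convergence in the ultraweak* topology of `B_s(X, X*)`, which is the topology defined by the
functionals `P ↦ ∑ i, ⟨P (x i), y i⟩` with `∑ i, ‖x i‖ ^ 2 < ∞` and `∑ i, ‖y i‖ ^ 2 < ∞`. It is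
the weak* topology given by the predual, the projective (symmetric) tensor square of `X`. -/
def TendstoUW {ι : Type*} (F : ι → SymOp X) (l : Filter ι) (Q : SymOp X) : Prop :=
  ∀ x y : ℕ → X, Summable (fun i => ‖x i‖ ^ 2) → Summable (fun i => ‖y i‖ ^ 2) →
    Tendsto (fun i => uwPairing x y (F i)) l (𝓝 (uwPairing x y Q))

theorem summable_uwPairing {x y : ℕ → X} (hx : Summable (fun i => ‖x i‖ ^ 2))
    (hy : Summable (fun i => ‖y i‖ ^ 2)) (P : X →L[ℝ] StrongDual ℝ X) :
    Summable (fun i => P (x i) (y i)) := by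
  refine Summable.of_norm_bounded ((hx.add hy).mul_left ‖P‖) fun i => ?_
  refine (P.le_opNorm₂ (x i) (y i)).trans ?_
  rw [mul_assoc]
  refine mul_le_mul_of_nonneg_left ?_ (norm_nonneg P)
  nlinarith [sq_nonneg (‖x i‖ - ‖y i‖), sq_nonneg ‖x i‖, sq_nonneg ‖y i‖]

theorem TendstoUW.add {ι : Type*} {F G : ι → SymOp X} {l : Filter ι} {P Q : SymOp X}
    (hF : TendstoUW F l P) (hG : TendstoUW G l Q) : TendstoUW (fun i => F i + G i) l (P + Q) := by
  intro x y hx hy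
  have key : ∀ A B : SymOp X,
      uwPairing x y (A + B : SymOp X) = uwPairing x y A + uwPairing x y B := fun A B =>
    (summable_uwPairing hx hy (A : X →L[ℝ] StrongDual ℝ X)).tsum_add
      (summable_uwPairing hx hy (B : X →L[ℝ] StrongDual ℝ X))
  simp only [key]
  exact (hF x y hx hy).add (hG x y hx hy)

theorem TendstoUW.const_smul {ι : Type*} {F : ι → SymOp X} {l : Filter ι} {P : SymOp X}
    (c : ℝ) (hF : TendstoUW F l P) : TendstoUW (fun i => c • F i) l (c • P) := by
  intro x y hx hy
  have key : ∀ A : SymOp X, uwPairing x y (c • A : SymOp X) = c * uwPairing x y A := fun A =>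
    tsum_mul_left
  simp only [key]
  exact (hF x y hx hy).const_mul c

theorem TendstoUW.unique {ι : Type*} {F : ι → SymOp X} {l : Filter ι} [l.NeBot] {P Q : SymOp X}
    (hP : TendstoUW F l P) (hQ : TendstoUW F l Q) : P = Q := by
  refine SymOp.coe_injective ?_
  ext a b
  have hs : ∀ a : X, Summable fun i => ‖(Pi.single 0 a : ℕ → X) i‖ ^ 2 := fun a =>
    summable_of_ne_finset_zero (s := {0}) fun i hi => by
      have hi' : i ≠ 0 := by simpa using hi
      simp [Pi.single_eq_of_ne hi']
  have key : ∀ A : X →L[ℝ] StrongDual ℝ X,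
      uwPairing (Pi.single 0 a) (Pi.single 0 b) A = A a b := fun A => by
    rw [uwPairing, tsum_eq_single 0]
    · simp
    · intro i hi
      simp [Pi.single_eq_of_ne hi]
  have h := tendsto_nhds_unique (hP _ _ (hs a) (hs b)) (hQ _ _ (hs a) (hs b))
  rwa [key, key] at h

end Symmetric

namespace C0Semigroup

variable {X : Type*} [NormedAddCommGroup X] [NormedSpace ℝ X]

/-- The Lyapunov semigroup `P ↦ T*(t) P T(t)` on `B_s(X, X*)`, that is,
`⟨(T*(t) P T(t)) x, y⟩ = ⟨P T(t) x, T(t) y⟩`. -/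
def lyapunovSemigroup (T : C0Semigroup X) (t : ℝ) : SymOp X →ₗ[ℝ] SymOp X where
  toFun P := ⟨(P : X →L[ℝ] StrongDual ℝ X).bilinearComp (T.op t) (T.op t),
    fun x y => P.2 (T.op t x) (T.op t y)⟩
  map_add' _ _ := rfl
  map_smul' _ _ := rfl

/-- The graph of the Lyapunov generator: the pairs `(P, Q)` such that `(T*(h) P T(h) - P) / h → Q`
in the ultraweak* (equivalently, weak*) topology as `h → 0+`. -/
def lyapunovGeneratorGraph (T : C0Semigroup X) : Submodule ℝ (SymOp X × SymOp X) where
  carrier := {p | TendstoUW (fun h : ℝ => h⁻¹ • (T.lyapunovSemigroup h p.1 - p.1)) (𝓝[>] 0) p.2}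
  zero_mem' := by
    intro x y _ _
    simp
  add_mem' := by
    intro p q hp hq
    have h := TendstoUW.add hp hq
    have e : (fun h : ℝ => h⁻¹ • (T.lyapunovSemigroup h (p + q).1 - (p + q).1)) =
        fun h : ℝ => h⁻¹ • (T.lyapunovSemigroup h p.1 - p.1) +
          h⁻¹ • (T.lyapunovSemigroup h q.1 - q.1) := by
      funext h
      rw [Prod.fst_add, map_add, ← smul_add]
      congr 1
      abel
    rw [Set.mem_ofPred_eq, e]
    exact h
  smul_mem' := by
    intro c p hp
    have h := TendstoUW.const_smul c hp
    have e : (fun h : ℝ => h⁻¹ • (T.lyapunovSemigroup h (c • p).1 - (c • p).1)) =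
        fun h : ℝ => c • h⁻¹ • (T.lyapunovSemigroup h p.1 - p.1) := by
      funext h
      rw [Prod.smul_fst, map_smul, ← smul_sub, smul_comm]
    rw [Set.mem_ofPred_eq, e]
    exact h

/-- The Lyapunov generator `L_A` on `B_s(X, X*)`: the weak* generator of the Lyapunov
semigroup. -/
def lyapunovGenerator (T : C0Semigroup X) : SymOp X →ₗ.[ℝ] SymOp X :=
  T.lyapunovGeneratorGraph.toLinearPMap

theorem mem_graph_lyapunovGenerator (T : C0Semigroup X) (P Q : SymOp X) :
    (P, Q) ∈ T.lyapunovGenerator.graph ↔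
      TendstoUW (fun h : ℝ => h⁻¹ • (T.lyapunovSemigroup h P - P)) (𝓝[>] 0) Q := by
  rw [lyapunovGenerator, Submodule.toLinearPMap_graph_eq]
  · exact Iff.rfl
  · rintro ⟨a, b⟩ hp (rfl : a = 0)
    refine TendstoUW.unique hp ?_
    intro x y _ _
    simp

end C0Semigroup

section BoundedInverse

variable {E : Type*} [NormedAddCommGroup E] [NormedSpace ℝ E]

/-- `R` is a bounded inverse of the unbounded operator `L`: a bounded everywhere defined operator
with values in the domain of `L` such that `L R = 1` on `E` and `R L = 1` on the domain of `L`. -/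
def IsBoundedInverse (L : E →ₗ.[ℝ] E) (R : E →L[ℝ] E) : Prop :=
  (∀ z : E, ∃ h : R z ∈ L.domain, L ⟨R z, h⟩ = z) ∧ ∀ w : L.domain, R (L w) = w

end BoundedInverse

section Control

variable {X V : Type*} [NormedAddCommGroup X] [NormedSpace ℝ X]
  [NormedAddCommGroup V] [InnerProductSpace ℝ V]

/-- The operator `C*C : X → X*`, where the Hilbert space `V` is identified with its dual:
`⟨C*C x, y⟩ = (C x, C y)_V`. -/
def adjMulSelf (C : X →L[ℝ] V) : X →L[ℝ] StrongDual ℝ X :=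
  ((innerSL ℝ : V →L[ℝ] V →L[ℝ] ℝ)).bilinearComp C C

/-- `P(D_A) ⊆ D_{A*}` and `A* P + P A = -Q` on `D_A`. -/
def SolvesLyapunov (A : X →ₗ.[ℝ] X) (Q P : X →L[ℝ] StrongDual ℝ X) : Prop :=
  ∃ h : ∀ x : A.domain, P x ∈ (banachAdjoint A).domain,
    ∀ x : A.domain, banachAdjoint A ⟨P x, h x⟩ + P (A x) = -Q x

/-- `(C, A)` is exponentially detectable: for some bounded `L : V → X` the operator `A - L C`, with
the domain of `A`, generates an exponentially stable `C₀` semigroup. -/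
def ExponentiallyDetectable (C : X →L[ℝ] V) (A : X →ₗ.[ℝ] X) : Prop :=
  ∃ (L : V →L[ℝ] X) (S : C0Semigroup X),
    S.generator = (-(L.comp C : X →L[ℝ] X) : X →ₗ[ℝ] X) +ᵥ A ∧ S.IsExponentiallyStable

/-- `(C, A)` is detectable in `L²`, where `A` is the generator of `T`: for every `x`, if
`‖C T(t) x‖ ^ 2` is integrable over `(0, ∞)`, then so is `‖T(t) x‖ ^ 2`. -/
def L2Detectable (C : X →L[ℝ] V) (T : C0Semigroup X) : Prop :=
  ∀ x : X, IntegrableOn (fun t : ℝ => ‖C (T.op t x)‖ ^ 2) (Set.Ioi 0) →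
    IntegrableOn (fun t : ℝ => ‖T.op t x‖ ^ 2) (Set.Ioi 0)

/-- The Lyapunov equation `A* P + P A = -C*C` has a solution `P` in the cone `B_s⁺(X, X*)` such
that `P(D_A) ⊆ D_{A*}`. -/
def LyapunovEqSolvable (C : X →L[ℝ] V) (A : X →ₗ.[ℝ] X) : Prop :=
  ∃ P : SymOp X, IsPosDef (P : X →L[ℝ] StrongDual ℝ X) ∧ SolvesLyapunov A (adjMulSelf C) P

/-- The Lyapunov generator `L_A` has a bounded inverse on `B_s(X, X*)` and `-(L_A)⁻¹ ≥ 0`, that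
is, `-(L_A)⁻¹` maps positive definite operators to positive definite ones. -/
def LyapunovNegInvertible (T : C0Semigroup X) : Prop :=
  ∃ R : SymOp X →L[ℝ] SymOp X, IsBoundedInverse T.lyapunovGenerator R ∧
    ∀ Q : SymOp X, IsPosDef (Q : X →L[ℝ] StrongDual ℝ X) →
      IsPosDef ((-R Q : SymOp X) : X →L[ℝ] StrongDual ℝ X)

end Control

end

/-! The three conditions are proved equivalent under detectability in `L²`, by the cycle (i) ⇒ (ii)
⇒ (iii) ⇒ (i); only the first implication uses detectability.

(i) ⇒ (ii): if `P` solves the Lyapunov equation, then along an orbit starting in the domain of `A`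
the function `⟨P T(t)x, T(t)x⟩` has derivative `-‖C T(t)x‖²`. Since `P ≥ 0`, the integral of `‖C
T(t)x‖²` is at most `⟨Px, x⟩`, and density of the domain extends this to all `x`
(`LyapunovEqSolvable.integrableOn`). Detectability then makes every orbit square integrable, and
Datko's theorem gives stability.

(ii) ⇒ (iii): for a stable semigroup `R Q = ∫₀^∞ T(t)* Q T(t) dt` converges and preserves
positivity, and `-R` inverts the Lyapunov generator.

(iii) ⇒ (i): the preimage `P` of `-C*C` under the Lyapunov generator is a solution; comparing two
expressions for the right derivative of `⟨P T(t)x, T(t)y⟩` at `0` yields both `P(D_A) ⊆ D_{A*}` and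
the equation.

Exponential detectability implies detectability in `L²` by variation of constants, `T(t)x = S(t)x +
∫₀ᵗ S(t-s) L C T(s)x ds` with `S` stable: convolution with a decaying exponential is bounded on
`L²`. -/

theorem hasDerivWithinAt_Ioi_iff_tendsto {E : Type*} [NormedAddCommGroup E] [NormedSpace ℝ E]
    {f : ℝ → E} {f' : E} {t : ℝ} :
    HasDerivWithinAt f f' (Set.Ioi t) t ↔
      Tendsto (fun h : ℝ => h⁻¹ • (f (t + h) - f t)) (𝓝[>] 0) (𝓝 f') := by
  rw [hasDerivWithinAt_iff_tendsto_slope' (by simp)]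
  have e : 𝓝[>] t = map (fun h => t + h) (𝓝[>] (0 : ℝ)) := by
    simp
  rw [e, tendsto_map'_iff]
  refine tendsto_congr fun h => ?_
  simp [slope_def_module]

/-! ### Orbits of a `C₀` semigroup and density of the domain of its generator. -/

namespace C0Semigroup

variable {X : Type*} [NormedAddCommGroup X] [NormedSpace ℝ X]

/-- The semigroup extended to negative times by the identity. -/
noncomputable def flow (T : C0Semigroup X) (t : ℝ) : X →L[ℝ] X := T.op (max t 0)

theorem flow_of_nonneg (T : C0Semigroup X) {t : ℝ} (ht : 0 ≤ t) : T.flow t = T.op t := by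
  rw [flow, max_eq_left ht]

@[simp]
theorem flow_zero_apply (T : C0Semigroup X) (x : X) : T.flow 0 x = x := by
  rw [T.flow_of_nonneg le_rfl, T.op_zero]; rfl

theorem flow_add_apply (T : C0Semigroup X) {s t : ℝ} (hs : 0 ≤ s) (ht : 0 ≤ t) (x : X) :
    T.flow (s + t) x = T.flow s (T.flow t x) := by
  rw [T.flow_of_nonneg hs, T.flow_of_nonneg ht, T.flow_of_nonneg (add_nonneg hs ht),
    T.op_add s t hs ht]; rfl

theorem continuous_flow_apply (T : C0Semigroup X) (x : X) : Continuous fun t => T.flow t x := by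
  rw [← continuousOn_univ]
  exact (T.continuousOn_orbit x).comp (by fun_prop) fun t _ => le_max_right t 0

theorem mem_generator_graph_iff (T : C0Semigroup X) {x y : X} :
    (x, y) ∈ T.generator.graph ↔
      Tendsto (fun h : ℝ => h⁻¹ • (T.flow h x - x)) (𝓝[>] 0) (𝓝 y) := by
  rw [mem_graph_generator]
  refine tendsto_congr' ?_
  filter_upwards [self_mem_nhdsWithin] with h hh
  rw [T.flow_of_nonneg (le_of_lt hh)]

/-- Only right derivatives are needed: together with continuity they suffice for the fundamental
theorem of calculus, and `T(t+k) - T(t) = T(t)(T(k) - 1)` gives them at once. -/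
theorem hasDerivWithinAt_flow (T : C0Semigroup X) {x y : X} (h : (x, y) ∈ T.generator.graph)
    {t : ℝ} (ht : 0 ≤ t) :
    HasDerivWithinAt (fun s => T.flow s x) (T.flow t y) (Set.Ioi t) t := by
  rw [hasDerivWithinAt_Ioi_iff_tendsto]
  refine (((T.flow t).continuous.tendsto y).comp (T.mem_generator_graph_iff.1 h)).congr' ?_
  filter_upwards [self_mem_nhdsWithin] with k hk
  simp [T.flow_add_apply ht (le_of_lt hk)]

theorem flow_mem_generator_graph (T : C0Semigroup X) {x y : X}
    (h : (x, y) ∈ T.generator.graph) {t : ℝ} (ht : 0 ≤ t) :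
    (T.flow t x, T.flow t y) ∈ T.generator.graph := by
  rw [mem_generator_graph_iff]
  refine (hasDerivWithinAt_Ioi_iff_tendsto.1 (T.hasDerivWithinAt_flow h ht)).congr' ?_
  filter_upwards [self_mem_nhdsWithin] with k hk
  rw [add_comm, T.flow_add_apply (le_of_lt hk) ht]

variable [CompleteSpace X]

/-- Orbits are bounded on compact intervals, so the uniform boundedness principle applies; negative
times add nothing, as `flow` is the identity there. -/
theorem exists_norm_flow_le (T : C0Semigroup X) (a : ℝ) :
    ∃ M, 0 ≤ M ∧ ∀ t ≤ a, ‖T.flow t‖ ≤ M := by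
  obtain ⟨M, hM⟩ := banach_steinhaus (g := fun t : Set.Iic a => T.flow t) fun x => by
    obtain ⟨K, hK⟩ := (isCompact_Icc (a := (0 : ℝ)) (b := max a 0)).exists_bound_of_continuousOn
      (T.continuous_flow_apply x).continuousOn
    refine ⟨K, fun t => ?_⟩
    have := hK (max t 0) ⟨le_max_right _ _, max_le_max_right 0 t.2⟩
    rwa [flow, max_assoc, max_self] at this
  exact ⟨max M 0, le_max_right _ _, fun t ht => (hM ⟨t, ht⟩).trans (le_max_left _ _)⟩

theorem continuous_flow (T : C0Semigroup X) : Continuous fun p : ℝ × X => T.flow p.1 p.2 := by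
  refine continuous_iff_continuousAt.2 fun ⟨t, x⟩ => ?_
  obtain ⟨M, -, hM⟩ := T.exists_norm_flow_le (t + 1)
  have h1 : Tendsto (fun p : ℝ × X => T.flow p.1 (p.2 - x)) (𝓝 (t, x)) (𝓝 0) := by
    have h0 : Tendsto (fun p : ℝ × X => M * ‖p.2 - x‖) (𝓝 (t, x)) (𝓝 0) := by
      have : Continuous fun p : ℝ × X => M * ‖p.2 - x‖ := by fun_prop
      simpa using this.tendsto (t, x)
    refine squeeze_zero_norm' ?_ h0
    have : ∀ᶠ p : ℝ × X in 𝓝 (t, x), p.1 < t + 1 :=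
      continuous_fst.continuousAt.eventually_lt continuousAt_const (by simp)
    filter_upwards [this] with p hp
    exact (T.flow p.1).le_of_opNorm_le (hM _ hp.le) _
  have h2 : Tendsto (fun p : ℝ × X => T.flow p.1 x) (𝓝 (t, x)) (𝓝 (T.flow t x)) :=
    ((T.continuous_flow_apply x).comp continuous_fst).tendsto (t, x)
  have := h1.add h2
  simpa [ContinuousAt] using this

theorem continuous_flow_comp (T : C0Semigroup X) {α : Type*} [TopologicalSpace α] {f : α → ℝ}
    {g : α → X} (hf : Continuous f) (hg : Continuous g) : Continuous fun a => T.flow (f a) (g a) :=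
  T.continuous_flow.comp (hf.prodMk hg)

theorem integral_flow_mem_generator_graph (T : C0Semigroup X) (x : X) {h : ℝ} (hh : 0 ≤ h) :
    (∫ s in (0 : ℝ)..h, T.flow s x, T.flow h x - x) ∈ T.generator.graph := by
  have hc := T.continuous_flow_apply x
  have hd (u : ℝ) : HasDerivAt (fun u => ∫ s in (0 : ℝ)..u, T.flow s x) (T.flow u x) u :=
    hc.integral_hasStrictDerivAt 0 u |>.hasDerivAt
  have h1 := hasDerivWithinAt_Ioi_iff_tendsto.1 (hd h).hasDerivWithinAt
  have h0 := hasDerivWithinAt_Ioi_iff_tendsto.1 (hd 0).hasDerivWithinAt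
  rw [mem_generator_graph_iff]
  simp only [flow_zero_apply] at h0
  refine (h1.sub h0).congr' ?_
  filter_upwards [self_mem_nhdsWithin] with k hk
  have e : T.flow k (∫ s in (0 : ℝ)..h, T.flow s x) = ∫ s in (0 : ℝ)..h, T.flow (k + s) x := by
    rw [← ContinuousLinearMap.intervalIntegral_comp_comm _ (hc.intervalIntegrable _ _)]
    refine intervalIntegral.integral_congr fun s hs => ?_
    rw [Set.uIcc_of_le hh] at hs
    exact (T.flow_add_apply (le_of_lt hk) hs.1 x).symm
  rw [e, intervalIntegral.integral_comp_add_left (fun s => T.flow s x), ← smul_sub]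
  have a1 := intervalIntegral.integral_add_adjacent_intervals
    (hc.intervalIntegrable (μ := volume) 0 k) (hc.intervalIntegrable k (k + h))
  simp only [add_zero, zero_add, intervalIntegral.integral_same, sub_zero, add_comm h k, ← a1]
  congr 1
  abel

/-- The averages `k⁻¹ ∫₀ᵏ T(s)x ds` lie in the domain and tend to `x` as `k → 0+`. -/
theorem dense_domain_generator (T : C0Semigroup X) : Dense (T.generator.domain : Set X) := by
  intro x
  have hd : HasDerivAt (fun u => ∫ s in (0 : ℝ)..u, T.flow s x) (T.flow 0 x) 0 :=
    (T.continuous_flow_apply x).integral_hasStrictDerivAt 0 0 |>.hasDerivAt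
  have h0 := hasDerivWithinAt_Ioi_iff_tendsto.1 (hd.hasDerivWithinAt (s := Set.Ioi 0))
  rw [flow_zero_apply] at h0
  refine mem_closure_of_tendsto h0 ?_
  filter_upwards [self_mem_nhdsWithin] with k hk
  simp only [zero_add, intervalIntegral.integral_same, sub_zero]
  exact T.generator.domain.smul_mem _
    (LinearPMap.mem_domain_of_mem_graph (T.integral_flow_mem_generator_graph x (le_of_lt hk)))

end C0Semigroup

/-! ### Integral estimates on the half line. -/

theorem integrableOn_Ioi_zero_of_integral_le {f : ℝ → ℝ} (hf : Continuous f) (h0 : ∀ t, 0 ≤ f t)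
    {K : ℝ} (hK : ∀ t, 0 ≤ t → ∫ s in (0 : ℝ)..t, f s ≤ K) : IntegrableOn f (Set.Ioi 0) := by
  refine integrableOn_Ioi_of_intervalIntegral_norm_bounded (b := fun t : ℝ => t) K 0
    (fun t => hf.integrableOn_Ioc) tendsto_id ?_
  filter_upwards [eventually_ge_atTop 0] with t ht
  simpa only [Real.norm_of_nonneg (h0 _)] using hK t ht

theorem integral_le_integral_Ioi_zero {f : ℝ → ℝ} (h0 : ∀ t, 0 ≤ f t)
    (hf : IntegrableOn f (Set.Ioi 0)) {t : ℝ} (ht : 0 ≤ t) :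
    ∫ s in (0 : ℝ)..t, f s ≤ ∫ s in Set.Ioi 0, f s := by
  rw [intervalIntegral.integral_of_le ht]
  exact setIntegral_mono_set hf (ae_of_all _ h0) Set.Ioc_subset_Ioi_self.eventuallyLE

/-- Convolution with a decaying exponential is bounded on `L²`. -/
theorem integral_sq_exp_convolution_le {g : ℝ → ℝ} (hg : Continuous g) {ω : ℝ} (hω : 0 < ω)
    {t : ℝ} (ht : 0 ≤ t) :
    ∫ s in (0 : ℝ)..t, (∫ r in (0 : ℝ)..s, Real.exp (-(ω * (s - r))) * g r) ^ 2 ≤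
      (ω ^ 2)⁻¹ * ∫ s in (0 : ℝ)..t, g s ^ 2 := by
  set u : ℝ → ℝ := fun s => Real.exp (-(ω * s)) * ∫ r in (0 : ℝ)..s, Real.exp (ω * r) * g r
  have hu (s : ℝ) : ∫ r in (0 : ℝ)..s, Real.exp (-(ω * (s - r))) * g r = u s := by
    simp only [u, ← intervalIntegral.integral_const_mul]
    refine intervalIntegral.integral_congr fun r _ => ?_
    simp only [← mul_assoc, ← Real.exp_add]
    ring_nf
  -- The convolution `u` solves `u' = -ω u + g`, which turns the bound into an energy estimate.
  have hd (s : ℝ) : HasDerivAt u (-ω * u s + g s) s := by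
    have h1 : HasDerivAt (fun s => Real.exp (-(ω * s))) (Real.exp (-(ω * s)) * (-(ω * 1))) s :=
      ((hasDerivAt_id s).const_mul ω).neg.exp
    have h2 : HasDerivAt (fun s => ∫ r in (0 : ℝ)..s, Real.exp (ω * r) * g r)
        (Real.exp (ω * s) * g s) s :=
      (Continuous.integral_hasStrictDerivAt (by fun_prop) 0 s).hasDerivAt
    refine (h1.mul h2).congr_deriv ?_
    have : Real.exp (-(ω * s)) * Real.exp (ω * s) = 1 := by rw [← Real.exp_add]; simp
    simp only [u]
    linear_combination g s * this
  have hc : Continuous u := continuous_iff_continuousAt.2 fun s => (hd s).continuousAt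
  have hftc : ∫ s in (0 : ℝ)..t, 2 * u s * (-ω * u s + g s) = u t ^ 2 - u 0 ^ 2 :=
    intervalIntegral.integral_eq_sub_of_hasDerivAt
      (f := fun s => u s ^ 2) (fun s _ => ((hd s).fun_pow 2).congr_deriv (by simp))
      (Continuous.intervalIntegrable (by fun_prop) _ _)
  -- This is `(ω u - g)² ≥ 0` written as `ω² u² + ω (u²)' ≤ g²`; the total derivative integrates to
  -- `ω u(t)² ≥ 0` and can be dropped.
  have hle : ∫ s in (0 : ℝ)..t, (ω ^ 2 * u s ^ 2 + ω * (2 * u s * (-ω * u s + g s))) ≤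
      ∫ s in (0 : ℝ)..t, g s ^ 2 := by
    refine intervalIntegral.integral_mono_on ht (Continuous.intervalIntegrable (by fun_prop) _ _)
      (Continuous.intervalIntegrable (by fun_prop) _ _) fun s _ => ?_
    nlinarith [sq_nonneg (ω * u s - g s)]
  rw [intervalIntegral.integral_add (Continuous.intervalIntegrable (by fun_prop) _ _)
    (Continuous.intervalIntegrable (by fun_prop) _ _), intervalIntegral.integral_const_mul,
    intervalIntegral.integral_const_mul, hftc] at hle
  have h0 : u 0 = 0 := by simp [u]
  simp only [hu]
  rw [le_inv_mul_iff₀ (by positivity)]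
  rw [h0] at hle
  have : 0 ≤ ω * u t ^ 2 := by positivity
  linarith

/-! ### Datko's theorem and variation of constants. -/

namespace C0Semigroup

variable {X : Type*} [NormedAddCommGroup X] [NormedSpace ℝ X]

theorem l2Detectable_iff {V : Type*} [NormedAddCommGroup V] [InnerProductSpace ℝ V]
    (C : X →L[ℝ] V) (T : C0Semigroup X) :
    L2Detectable C T ↔ ∀ x : X, IntegrableOn (fun t => ‖C (T.flow t x)‖ ^ 2) (Set.Ioi 0) →
      IntegrableOn (fun t => ‖T.flow t x‖ ^ 2) (Set.Ioi 0) := by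
  refine forall_congr' fun x => imp_congr ?_ ?_ <;>
  · refine integrableOn_congr_fun (fun t ht => ?_) measurableSet_Ioi
    simp only [T.flow_of_nonneg (le_of_lt ht)]

theorem flow_nat_mul_apply (T : C0Semigroup X) {τ : ℝ} (hτ : 0 ≤ τ) (n : ℕ) (x : X) :
    T.flow (n * τ) x = (T.flow τ ^ n) x := by
  induction n generalizing x with
  | zero => simp
  | succ n ih =>
    rw [pow_succ, mul_apply_eq_comp, ← ih, ← T.flow_add_apply (by positivity) hτ]
    push_cast
    ring_nf

variable [CompleteSpace X]

theorem isExponentiallyStable_of_norm_flow_lt_one (T : C0Semigroup X) {τ : ℝ} (hτ : 0 < τ)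
    (h : ‖T.flow τ‖ < 1) : T.IsExponentiallyStable := by
  obtain ⟨M, hM0, hM⟩ := T.exists_norm_flow_le τ
  -- The maximum with `1 / 2` keeps `r` positive, so that `log r` is meaningful even if `T(τ) = 0`.
  set r := max ‖T.flow τ‖ (1 / 2)
  have hr0 : 0 < r := lt_max_of_lt_right (by norm_num)
  have hr1 : r < 1 := max_lt h (by norm_num)
  set ω := -Real.log r / τ
  have hω : 0 < ω := div_pos (neg_pos.2 (Real.log_neg hr0 hr1)) hτ
  have hωτ : Real.log r = -(ω * τ) := by simp only [ω]; field_simp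
  refine ⟨M * Real.exp (ω * τ), ω, hω, fun t ht => ?_⟩
  set n := ⌊t / τ⌋₊
  have hn : n * τ ≤ t := (le_div_iff₀ hτ).1 (Nat.floor_le (by positivity))
  have hn' : t < (n + 1) * τ := (div_lt_iff₀ hτ).1 (Nat.lt_floor_add_one _)
  have hrn : r ^ n ≤ Real.exp (ω * τ) * Real.exp (-(ω * t)) := by
    rw [← Real.exp_log hr0, ← Real.exp_nat_mul, ← Real.exp_add, Real.exp_le_exp, hωτ]
    nlinarith
  -- The case `n = 0` is separate because the identity has norm `0` on the trivial space.
  have hpow (n : ℕ) : ‖T.flow τ ^ n‖ ≤ ‖T.flow τ‖ ^ n := by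
    rcases n.eq_zero_or_pos with rfl | hn
    · exact ContinuousLinearMap.norm_id_le
    · exact norm_pow_le' _ hn
  rw [← T.flow_of_nonneg ht]
  refine ContinuousLinearMap.opNorm_le_bound _ (by positivity) fun x => ?_
  have e : T.flow t x = (T.flow τ ^ n) (T.flow (t - n * τ) x) := by
    rw [← T.flow_nat_mul_apply hτ.le, ← T.flow_add_apply (by positivity) (by linarith)]
    ring_nf
  calc ‖T.flow t x‖ ≤ ‖T.flow τ ^ n‖ * ‖T.flow (t - n * τ) x‖ := by
        rw [e]; exact ContinuousLinearMap.le_opNorm _ _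
    _ ≤ r ^ n * (M * ‖x‖) := by
        gcongr
        · exact (hpow n).trans (pow_le_pow_left₀ (norm_nonneg _) (le_max_left _ _) n)
        · exact (T.flow _).le_of_opNorm_le (hM _ (by linarith)) x
    _ ≤ (Real.exp (ω * τ) * Real.exp (-(ω * t))) * (M * ‖x‖) := by gcongr
    _ = _ := by ring

/-- For `s ∈ [k, k+1]`, `T(k+1)x = T(k+1-s) T(s)x` bounds the sample at `k+1` by the integral over
that unit interval. -/
theorem exists_sum_norm_sq_flow_le (T : C0Semigroup X) {x : X}
    (hx : IntegrableOn (fun t => ‖T.flow t x‖ ^ 2) (Set.Ioi 0)) :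
    ∃ K, 0 ≤ K ∧ ∀ n : ℕ, ∑ k ∈ Finset.range n, ‖T.flow (k + 1) x‖ ^ 2 ≤ K := by
  obtain ⟨M, hM0, hM⟩ := T.exists_norm_flow_le 1
  have hc : Continuous fun t => ‖T.flow t x‖ ^ 2 := ((T.continuous_flow_apply x).norm).pow 2
  have step (n : ℕ) : ∑ k ∈ Finset.range n, ‖T.flow (k + 1) x‖ ^ 2 ≤
      M ^ 2 * ∫ s in (0 : ℝ)..n, ‖T.flow s x‖ ^ 2 := by
    induction n with
    | zero => simp
    | succ n ih =>
      rw [Finset.sum_range_succ, ← intervalIntegral.integral_add_adjacent_intervals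
        (hc.intervalIntegrable 0 n) (hc.intervalIntegrable _ _), mul_add]
      refine add_le_add ih ?_
      have h1 : ∫ s in (n : ℝ)..(n + 1 : ℕ), ‖T.flow (n + 1) x‖ ^ 2 ≤
          ∫ s in (n : ℝ)..(n + 1 : ℕ), M ^ 2 * ‖T.flow s x‖ ^ 2 := by
        refine intervalIntegral.integral_mono_on (by simp) (by simp)
          ((hc.const_mul _).intervalIntegrable _ _) fun s hs => ?_
        have hs0 : 0 ≤ s := n.cast_nonneg.trans hs.1
        have hs1 : s ≤ n + 1 := by simpa using hs.2
        rw [← mul_pow]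
        gcongr
        have := T.flow_add_apply (s := n + 1 - s) (t := s) (by linarith) hs0 x
        rw [sub_add_cancel] at this
        rw [this]
        exact (T.flow _).le_of_opNorm_le (hM _ (by linarith [hs.1])) _
      simpa using h1
  refine ⟨M ^ 2 * ∫ s in Set.Ioi (0 : ℝ), ‖T.flow s x‖ ^ 2, by positivity, fun n => ?_⟩
  refine (step n).trans ?_
  gcongr
  exact integral_le_integral_Ioi_zero (fun _ => by positivity) hx n.cast_nonneg

/-- **Datko's theorem** for exponent `2`. -/
theorem isExponentiallyStable_of_integrableOn_sq (T : C0Semigroup X)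
    (hT : ∀ x, IntegrableOn (fun t => ‖T.flow t x‖ ^ 2) (Set.Ioi 0)) :
    T.IsExponentiallyStable := by
  choose K hK0 hK using fun x => T.exists_sum_norm_sq_flow_le (hT x)
  obtain ⟨M, hM⟩ := banach_steinhaus (g := fun n : ℕ => T.flow (n + 1)) fun x => by
    refine ⟨√(K x), fun n => Real.le_sqrt_of_sq_le ?_⟩
    exact (Finset.single_le_sum (f := fun k : ℕ => ‖T.flow (k + 1) x‖ ^ 2)
      (fun _ _ => by positivity) (Finset.self_mem_range_succ n)).trans (hK x (n + 1))
  have hM0 : 0 ≤ M := (norm_nonneg _).trans (hM 0)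
  -- Uniform boundedness of the powers gives `‖T(n+1)x‖ ≤ M ‖T(k+1)x‖` for each `k < n`. Summing the
  -- squares over `k` bounds `n ‖T(n+1)x‖²` independently of `n`.
  obtain ⟨N, hN⟩ := banach_steinhaus (g := fun n : ℕ => √n • T.flow (n + 1)) fun x => by
    refine ⟨√(M ^ 2 * K x), fun n => Real.le_sqrt_of_sq_le ?_⟩
    have h1 (k : ℕ) (hk : k ∈ Finset.range n) :
        ‖T.flow (n + 1) x‖ ^ 2 ≤ M ^ 2 * ‖T.flow (k + 1) x‖ ^ 2 := by
      rw [← mul_pow]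
      gcongr
      obtain ⟨d, rfl⟩ := Nat.exists_eq_add_of_lt (Finset.mem_range.1 hk)
      have : T.flow ((k + d + 1 : ℕ) + 1) x = T.flow (d + 1) (T.flow (k + 1) x) := by
        rw [← T.flow_add_apply (by positivity) (by positivity)]
        congr 2
        push_cast
        ring
      rw [this]
      exact (T.flow _).le_of_opNorm_le (hM d) _
    have h2 := (Finset.sum_le_sum h1).trans_eq (Finset.mul_sum _ _ _).symm
    rw [Finset.sum_const, Finset.card_range, nsmul_eq_mul] at h2
    rw [smul_apply, norm_smul, mul_pow, Real.norm_eq_abs, sq_abs,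
      Real.sq_sqrt n.cast_nonneg]
    exact h2.trans (by gcongr; exact hK x n)
  -- `√n ‖T(n+1)‖ ≤ N < √n` forces `‖T(n+1)‖ < 1`.
  obtain ⟨n, hn⟩ := exists_nat_gt (N ^ 2)
  have hN0 : 0 ≤ N := (norm_nonneg _).trans (hN 0)
  refine T.isExponentiallyStable_of_norm_flow_lt_one (τ := n + 1) (by positivity) ?_
  have h := hN n
  rw [norm_smul, Real.norm_of_nonneg (Real.sqrt_nonneg _)] at h
  have hlt : N < √n := Real.lt_sqrt_of_sq_lt hn
  by_contra! hge
  nlinarith [Real.sqrt_nonneg n]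

/-- Variation of constants for a bounded perturbation `D` of the generator. -/
theorem flow_eq_add_integral (T S : C0Semigroup X) (D : X →L[ℝ] X)
    (h : ∀ x y, (x, y) ∈ T.generator.graph → (x, y - D x) ∈ S.generator.graph)
    (x : X) {t : ℝ} (ht : 0 ≤ t) :
    T.flow t x = S.flow t x + ∫ s in (0 : ℝ)..t, S.flow (t - s) (D (T.flow s x)) := by
  have hcont : Continuous fun p : X × ℝ => S.flow (t - p.2) (D (T.flow p.2 p.1)) :=
    S.continuous_flow_comp (by fun_prop)
      (D.continuous.comp (T.continuous_flow_comp continuous_snd continuous_fst))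
  have hclosed : IsClosed {x | T.flow t x =
      S.flow t x + ∫ s in (0 : ℝ)..t, S.flow (t - s) (D (T.flow s x))} :=
    isClosed_eq (T.flow t).continuous ((S.flow t).continuous.add
      (intervalIntegral.continuous_parametric_intervalIntegral_of_continuous' hcont 0 t))
  refine hclosed.closure_subset_iff.2 ?_ (T.dense_domain_generator x)
  intro x hx
  obtain ⟨y, hxy⟩ := LinearPMap.mem_domain_iff.1 hx
  -- Both sides are continuous in `x`, so `x` may be taken in the domain. Factoring `S(t-s) =
  -- S(t-s-k) S(k)` makes the quotient `S(t-s-k)` applied to a difference of generator quotients,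
  -- which tends to `D T(s)x`; joint continuity of `S` gives the limit.
  have hd (s : ℝ) (hs : s ∈ Set.Ioo 0 t) : HasDerivWithinAt
      (fun s => S.flow (t - s) (T.flow s x)) (S.flow (t - s) (D (T.flow s x))) (Set.Ioi s) s := by
    have hz := T.flow_mem_generator_graph hxy hs.1.le
    have hz1 := hasDerivWithinAt_Ioi_iff_tendsto.1 (T.hasDerivWithinAt_flow hxy hs.1.le)
    have hz2 := S.mem_generator_graph_iff.1 (h _ _ hz)
    have hz3 := hz1.sub hz2
    rw [sub_sub_cancel] at hz3
    have hτ : Tendsto (fun k : ℝ => t - s - k) (𝓝[>] 0) (𝓝 (t - s)) := by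
      have : Continuous fun k : ℝ => t - s - k := by fun_prop
      simpa using (this.tendsto 0).mono_left nhdsWithin_le_nhds
    rw [hasDerivWithinAt_Ioi_iff_tendsto]
    refine ((S.continuous_flow.tendsto (t - s, D (T.flow s x))).comp
      (hτ.prodMk_nhds hz3)).congr' ?_
    filter_upwards [Ioo_mem_nhdsGT (sub_pos.2 hs.2)] with k hk
    have e : S.flow (t - s) (T.flow s x) = S.flow (t - s - k) (S.flow k (T.flow s x)) := by
      rw [← S.flow_add_apply (by linarith [hk.2]) hk.1.le, sub_add_cancel]
    simp only [Function.comp_apply, ← smul_sub, sub_sub_sub_cancel_right, map_smul, map_sub, e,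
      sub_add_eq_sub_sub]
  have hftc := intervalIntegral.integral_eq_sub_of_hasDeriv_right_of_le ht
    (S.continuous_flow_comp (f := fun s => t - s) (by fun_prop)
      (T.continuous_flow_apply x)).continuousOn hd
    ((hcont.comp (Continuous.prodMk_right x)).intervalIntegrable 0 t)
  simp only [sub_self, flow_zero_apply, sub_zero] at hftc
  simp [hftc]

end C0Semigroup

/-! ### Exponential detectability implies detectability in `L²`. -/

open C0Semigroup in
theorem ExponentiallyDetectable.l2Detectable {X V : Type*} [NormedAddCommGroup X]
    [NormedSpace ℝ X] [CompleteSpace X] [NormedAddCommGroup V] [InnerProductSpace ℝ V]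
    {T : C0Semigroup X} {C : X →L[ℝ] V} (h : ExponentiallyDetectable C T.generator) :
    L2Detectable C T := by
  obtain ⟨L, S, hS, M, ω, hω, hM⟩ := h
  rw [l2Detectable_iff]
  intro x hx
  have hM0 : 0 ≤ M := by simpa using (norm_nonneg _).trans (hM 0 le_rfl)
  have hgraph (x y : X) (hxy : (x, y) ∈ T.generator.graph) :
      (x, y - (L.comp C) x) ∈ S.generator.graph := by
    rw [hS]
    obtain ⟨z, rfl, rfl⟩ := (LinearPMap.mem_graph_iff _).1 hxy
    refine (LinearPMap.mem_graph_iff _).2 ⟨z, rfl, ?_⟩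
    rw [LinearPMap.vadd_apply]
    simp [sub_eq_neg_add]
  have hcT := T.continuous_flow_apply x
  set g : ℝ → ℝ := fun s => ‖C (T.flow s x)‖
  have hg : Continuous g := by fun_prop
  set u : ℝ → ℝ := fun s => ∫ r in (0 : ℝ)..s, Real.exp (-(ω * (s - r))) * g r
  have hSx (s : ℝ) (hs : 0 ≤ s) (z : X) : ‖S.flow s z‖ ≤ M * Real.exp (-(ω * s)) * ‖z‖ := by
    rw [S.flow_of_nonneg hs]
    exact (S.op s).le_of_opNorm_le (hM s hs) z
  have hu : Continuous u :=
    intervalIntegral.continuous_parametric_intervalIntegral_of_continuous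
      (f := fun s r => Real.exp (-(ω * (s - r))) * g r)
      (by simp only [Function.uncurry_def]; fun_prop) continuous_id
  have hTx (t : ℝ) (ht : 0 ≤ t) :
      ‖T.flow t x‖ ≤ M * ‖x‖ * Real.exp (-(ω * t)) + M * ‖L‖ * u t := by
    rw [flow_eq_add_integral T S (L.comp C) hgraph x ht]
    refine (norm_add_le _ _).trans (add_le_add ((hSx t ht x).trans_eq (by ring)) ?_)
    simp only [u]
    rw [← intervalIntegral.integral_const_mul]
    refine intervalIntegral.norm_integral_le_of_norm_le ht (ae_of_all _ fun r hr => ?_)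
      (Continuous.intervalIntegrable (by fun_prop) _ _)
    refine (hSx _ (sub_nonneg.2 hr.2) _).trans ?_
    rw [ContinuousLinearMap.comp_apply]
    calc M * Real.exp (-(ω * (t - r))) * ‖L (C (T.flow r x))‖
        ≤ M * Real.exp (-(ω * (t - r))) * (‖L‖ * g r) := by
          gcongr; exact L.le_opNorm _
      _ = _ := by ring
  have hexp : IntegrableOn (fun t : ℝ => Real.exp (-(ω * t)) ^ 2) (Set.Ioi 0) := by
    refine (integrableOn_exp_mul_Ioi (a := -(2 * ω)) (by linarith) 0).congr_fun (fun t _ => ?_)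
      measurableSet_Ioi
    simp only [← Real.exp_nat_mul]
    congr 1
    push_cast
    ring
  have hu2 : IntegrableOn (fun t => u t ^ 2) (Set.Ioi 0) := by
    refine integrableOn_Ioi_zero_of_integral_le (by fun_prop) (fun _ => sq_nonneg _)
      (K := (ω ^ 2)⁻¹ * ∫ s in Set.Ioi 0, g s ^ 2) fun t ht => ?_
    refine (integral_sq_exp_convolution_le hg hω ht).trans ?_
    gcongr
    exact integral_le_integral_Ioi_zero (fun _ => sq_nonneg _) hx ht
  refine Integrable.mono' ((hexp.const_mul (2 * (M * ‖x‖) ^ 2)).add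
    (hu2.const_mul (2 * (M * ‖L‖) ^ 2))) (by fun_prop) ?_
  refine (ae_restrict_iff' measurableSet_Ioi).2 (ae_of_all _ fun t ht => ?_)
  rw [Real.norm_of_nonneg (sq_nonneg _)]
  refine (pow_le_pow_left₀ (norm_nonneg _) (hTx t (le_of_lt ht)) 2).trans ?_
  simp only [Pi.add_apply]
  -- `(a + b)² ≤ 2a² + 2b²`.
  nlinarith [sq_nonneg (M * ‖x‖ * Real.exp (-(ω * t)) - M * ‖L‖ * u t)]

/-! ### Bilinear forms along orbits. -/

theorem TendstoUW.tendsto_apply {X : Type*} [NormedAddCommGroup X] [NormedSpace ℝ X]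
    {ι : Type*} {F : ι → SymOp X} {l : Filter ι} {Q : SymOp X} (h : TendstoUW F l Q) (a b : X) :
    Tendsto (fun i => (F i : X →L[ℝ] StrongDual ℝ X) a b) l
      (𝓝 ((Q : X →L[ℝ] StrongDual ℝ X) a b)) := by
  have hs (a : X) : Summable fun i => ‖(Pi.single 0 a : ℕ → X) i‖ ^ 2 :=
    summable_of_ne_finset_zero (s := {0}) fun i hi => by
      simp [Pi.single_eq_of_ne (show i ≠ 0 by simpa using hi)]
  have key (A : X →L[ℝ] StrongDual ℝ X) :
      uwPairing (Pi.single 0 a) (Pi.single 0 b) A = A a b := by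
    rw [uwPairing, tsum_eq_single 0]
    · simp
    · intro i hi
      simp [Pi.single_eq_of_ne hi]
  simpa only [key] using h _ _ (hs a) (hs b)

theorem adjMulSelf_apply {X V : Type*} [NormedAddCommGroup X] [NormedSpace ℝ X]
    [NormedAddCommGroup V] [InnerProductSpace ℝ V] (C : X →L[ℝ] V) (x y : X) :
    adjMulSelf C x y = inner ℝ (C x) (C y) := rfl

namespace C0Semigroup

variable {X : Type*} [NormedAddCommGroup X] [NormedSpace ℝ X]

theorem continuous_bilin_flow (T : C0Semigroup X) (Q : X →L[ℝ] StrongDual ℝ X) (x y : X) :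
    Continuous fun t => Q (T.flow t x) (T.flow t y) :=
  (Q.continuous.comp (T.continuous_flow_apply x)).clm_apply (T.continuous_flow_apply y)

theorem hasDerivWithinAt_bilin_flow (T : C0Semigroup X) (P : X →L[ℝ] StrongDual ℝ X)
    {x y x' y' : X} (hx : (x, x') ∈ T.generator.graph) (hy : (y, y') ∈ T.generator.graph)
    {t : ℝ} (ht : 0 ≤ t) :
    HasDerivWithinAt (fun s => P (T.flow s x) (T.flow s y))
      (P (T.flow t x') (T.flow t y) + P (T.flow t x) (T.flow t y')) (Set.Ioi t) t :=
  (P.hasFDerivAt.comp_hasDerivWithinAt t (T.hasDerivWithinAt_flow hx ht)).clm_apply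
    (T.hasDerivWithinAt_flow hy ht)

/-- The quotient at time `t` is the one defining the Lyapunov generator, tested on `T(t)x` and
`T(t)y`; hence `x` and `y` need not lie in the domain of `A`. -/
theorem hasDerivWithinAt_bilin_flow_of_mem (T : C0Semigroup X) {P Q : SymOp X}
    (h : (P, Q) ∈ T.lyapunovGenerator.graph) (x y : X) {t : ℝ} (ht : 0 ≤ t) :
    HasDerivWithinAt
      (fun s => (P : X →L[ℝ] StrongDual ℝ X) (T.flow s x) (T.flow s y))
      ((Q : X →L[ℝ] StrongDual ℝ X) (T.flow t x) (T.flow t y)) (Set.Ioi t) t := by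
  rw [hasDerivWithinAt_Ioi_iff_tendsto]
  refine (((T.mem_graph_lyapunovGenerator P Q).1 h).tendsto_apply
    (T.flow t x) (T.flow t y)).congr' ?_
  filter_upwards [self_mem_nhdsWithin] with k hk
  have hk' : 0 ≤ k := le_of_lt hk
  rw [add_comm t k, T.flow_add_apply hk' ht, T.flow_add_apply hk' ht, T.flow_of_nonneg hk']
  rfl

theorem integral_bilin_flow (T : C0Semigroup X) {P Q : SymOp X}
    (h : (P, Q) ∈ T.lyapunovGenerator.graph) (x y : X) {t : ℝ} (ht : 0 ≤ t) :
    ∫ s in (0 : ℝ)..t, (Q : X →L[ℝ] StrongDual ℝ X) (T.flow s x) (T.flow s y) =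
      (P : X →L[ℝ] StrongDual ℝ X) (T.flow t x) (T.flow t y) -
        (P : X →L[ℝ] StrongDual ℝ X) x y := by
  have := intervalIntegral.integral_eq_sub_of_hasDeriv_right_of_le ht
    (T.continuous_bilin_flow P x y).continuousOn
    (fun s hs => T.hasDerivWithinAt_bilin_flow_of_mem h x y hs.1.le)
    ((T.continuous_bilin_flow Q x y).intervalIntegrable _ _)
  simpa using this

/-! ### The integral operator of a stable semigroup. -/

section Stable

variable (T : C0Semigroup X) {M ω : ℝ}

theorem norm_bilin_flow_le (hM : ∀ t : ℝ, 0 ≤ t → ‖T.op t‖ ≤ M * Real.exp (-(ω * t)))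
    (Q : X →L[ℝ] StrongDual ℝ X) (x y : X) {t : ℝ} (ht : 0 ≤ t) :
    ‖Q (T.flow t x) (T.flow t y)‖ ≤
      ‖Q‖ * ‖x‖ * ‖y‖ * M ^ 2 * Real.exp (-(2 * ω) * t) := by
  have hb (z : X) : ‖T.flow t z‖ ≤ M * Real.exp (-(ω * t)) * ‖z‖ := by
    rw [T.flow_of_nonneg ht]
    exact (T.op t).le_of_opNorm_le (hM t ht) z
  have h0 : 0 ≤ M * Real.exp (-(ω * t)) := (norm_nonneg _).trans (hM t ht)
  have he : Real.exp (-(2 * ω) * t) = Real.exp (-(ω * t)) * Real.exp (-(ω * t)) := by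
    rw [← Real.exp_add]
    ring_nf
  calc ‖Q (T.flow t x) (T.flow t y)‖ ≤ ‖Q‖ * ‖T.flow t x‖ * ‖T.flow t y‖ := Q.le_opNorm₂ _ _
    _ ≤ ‖Q‖ * (M * Real.exp (-(ω * t)) * ‖x‖) * (M * Real.exp (-(ω * t)) * ‖y‖) := by
        gcongr <;> exact hb _
    _ = _ := by rw [he]; ring

theorem integrableOn_bilin_flow (hω : 0 < ω)
    (hM : ∀ t : ℝ, 0 ≤ t → ‖T.op t‖ ≤ M * Real.exp (-(ω * t)))
    (Q : X →L[ℝ] StrongDual ℝ X) (x y : X) :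
    IntegrableOn (fun t => Q (T.flow t x) (T.flow t y)) (Set.Ioi 0) := by
  refine Integrable.mono' ((integrableOn_exp_mul_Ioi (a := -(2 * ω)) (by linarith) 0).const_mul
    (‖Q‖ * ‖x‖ * ‖y‖ * M ^ 2)) (T.continuous_bilin_flow Q x y).aestronglyMeasurable ?_
  exact (ae_restrict_iff' measurableSet_Ioi).2
    (ae_of_all _ fun t ht => T.norm_bilin_flow_le hM Q x y (le_of_lt ht))

theorem norm_integral_bilin_flow_le (hω : 0 < ω)
    (hM : ∀ t : ℝ, 0 ≤ t → ‖T.op t‖ ≤ M * Real.exp (-(ω * t)))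
    (Q : X →L[ℝ] StrongDual ℝ X) (x y : X) :
    ‖∫ t in Set.Ioi 0, Q (T.flow t x) (T.flow t y)‖ ≤
      (M ^ 2 * ∫ t in Set.Ioi (0 : ℝ), Real.exp (-(2 * ω) * t)) * ‖Q‖ * ‖x‖ * ‖y‖ := by
  refine (norm_integral_le_of_norm_le ((integrableOn_exp_mul_Ioi (a := -(2 * ω))
    (by linarith) 0).const_mul (‖Q‖ * ‖x‖ * ‖y‖ * M ^ 2)) ?_).trans_eq ?_
  · exact (ae_restrict_iff' measurableSet_Ioi).2
      (ae_of_all _ fun t ht => T.norm_bilin_flow_le hM Q x y (le_of_lt ht))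
  · rw [integral_const_mul]
    ring

/-- The operator `Q ↦ ∫₀^∞ T(t)* Q T(t) dt` for an exponentially stable semigroup. -/
theorem exists_integralOperator (hT : T.IsExponentiallyStable) :
    ∃ R : SymOp X →L[ℝ] SymOp X, ∀ (Q : SymOp X) (x y : X),
      (R Q : X →L[ℝ] StrongDual ℝ X) x y =
        ∫ t in Set.Ioi 0, (Q : X →L[ℝ] StrongDual ℝ X) (T.flow t x) (T.flow t y) := by
  obtain ⟨M, ω, hω, hM⟩ := hT
  have hint := T.integrableOn_bilin_flow hω hM
  set K := M ^ 2 * ∫ t in Set.Ioi (0 : ℝ), Real.exp (-(2 * ω) * t)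
  have hK : 0 ≤ K := by positivity
  let B (Q : X →L[ℝ] StrongDual ℝ X) : X →L[ℝ] StrongDual ℝ X :=
    (LinearMap.mk₂ ℝ (fun x y => ∫ t in Set.Ioi 0, Q (T.flow t x) (T.flow t y))
      (fun x x' y => by
        simp only [map_add, add_apply]; exact integral_add (hint Q x y) (hint Q x' y))
      (fun c x y => by simp only [map_smul, smul_apply]; exact integral_smul c _)
      (fun x y y' => by simp only [map_add]; exact integral_add (hint Q x y) (hint Q x y'))
      (fun c x y => by simp only [map_smul]; exact integral_smul c _)).mkContinuous₂ (K * ‖Q‖)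
      fun x y => T.norm_integral_bilin_flow_le hω hM Q x y
  have hB (Q : X →L[ℝ] StrongDual ℝ X) (x y : X) :
      B Q x y = ∫ t in Set.Ioi 0, Q (T.flow t x) (T.flow t y) := rfl
  let R : SymOp X →ₗ[ℝ] SymOp X :=
    { toFun := fun Q => ⟨B Q, fun x y => by
        rw [hB, hB]
        exact integral_congr_ae (ae_of_all _ fun t => Q.2 _ _)⟩
      map_add' := fun P Q => by
        refine SymOp.coe_injective ?_
        ext x y
        exact integral_add (hint P x y) (hint Q x y)
      map_smul' := fun c Q => by
        refine SymOp.coe_injective ?_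
        ext x y
        exact integral_smul c _ }
  refine ⟨R.mkContinuous K fun Q => ?_, fun Q x y => rfl⟩
  exact LinearMap.mkContinuous₂_norm_le _ (mul_nonneg hK (norm_nonneg _))
    fun x y => T.norm_integral_bilin_flow_le hω hM Q x y

end Stable

/-! ### Inverting the Lyapunov generator, and the equivalence. -/

variable [CompleteSpace X]

/-- Each term converges by the fundamental theorem of calculus. The local bound on `‖T(s)‖` supplies
a summable majorant, so dominated convergence upgrades this to ultraweak* convergence. -/
theorem tendstoUW_average (T : C0Semigroup X) (Q : SymOp X) (F : ℝ → SymOp X)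
    (hF : ∀ h, 0 < h → ∀ x y, (F h : X →L[ℝ] StrongDual ℝ X) x y =
      h⁻¹ * ∫ s in (0 : ℝ)..h, (Q : X →L[ℝ] StrongDual ℝ X) (T.flow s x) (T.flow s y)) :
    TendstoUW F (𝓝[>] 0) Q := by
  intro x y hx hy
  obtain ⟨M, hM0, hM⟩ := T.exists_norm_flow_le 1
  refine tendsto_tsum_of_dominated_convergence
    (bound := fun i => ‖Q‖ * M ^ 2 * (‖x i‖ ^ 2 + ‖y i‖ ^ 2))
    ((hx.add hy).mul_left _) (fun i => ?_) ?_
  · have hd : HasDerivAt (fun u => ∫ s in (0 : ℝ)..u,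
        (Q : X →L[ℝ] StrongDual ℝ X) (T.flow s (x i)) (T.flow s (y i)))
        ((Q : X →L[ℝ] StrongDual ℝ X) (T.flow 0 (x i)) (T.flow 0 (y i))) 0 :=
      ((T.continuous_bilin_flow Q (x i) (y i)).integral_hasStrictDerivAt 0 0).hasDerivAt
    have h0 := hasDerivWithinAt_Ioi_iff_tendsto.1 (hd.hasDerivWithinAt (s := Set.Ioi 0))
    simp only [flow_zero_apply] at h0
    refine h0.congr' ?_
    filter_upwards [self_mem_nhdsWithin] with k hk
    simp [hF k hk]
  · filter_upwards [Ioo_mem_nhdsGT zero_lt_one] with h hh i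
    rw [hF h hh.1, norm_mul, norm_inv, Real.norm_of_nonneg hh.1.le]
    rw [inv_mul_le_iff₀ hh.1]
    have := intervalIntegral.norm_integral_le_of_norm_le_const (a := 0) (b := h)
      (f := fun s => (Q : X →L[ℝ] StrongDual ℝ X) (T.flow s (x i)) (T.flow s (y i)))
      (C := ‖Q‖ * M ^ 2 * (‖x i‖ ^ 2 + ‖y i‖ ^ 2)) fun s hs => by
        rw [Set.uIoc_of_le hh.1.le] at hs
        have hs1 : s ≤ 1 := hs.2.trans hh.2.le
        calc _ ≤ ‖Q‖ * ‖T.flow s (x i)‖ * ‖T.flow s (y i)‖ :=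
              ContinuousLinearMap.le_opNorm₂ (Q : X →L[ℝ] StrongDual ℝ X) _ _
          _ ≤ ‖Q‖ * (M * ‖x i‖) * (M * ‖y i‖) := by
              gcongr <;> exact (T.flow s).le_of_opNorm_le (hM s hs1) _
          _ = ‖Q‖ * M ^ 2 * (‖x i‖ * ‖y i‖) := by ring
          _ ≤ _ := by
              gcongr
              nlinarith [sq_nonneg (‖x i‖ - ‖y i‖), sq_nonneg ‖x i‖, sq_nonneg ‖y i‖]
    rwa [sub_zero, abs_of_pos hh.1, mul_comm] at this

theorem IsExponentiallyStable.lyapunovNegInvertible {T : C0Semigroup X}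
    (hT : T.IsExponentiallyStable) : LyapunovNegInvertible T := by
  obtain ⟨R, hR⟩ := T.exists_integralOperator hT
  obtain ⟨M, ω, hω, hM⟩ := hT
  have hint := T.integrableOn_bilin_flow hω hM
  have hneg (Q : SymOp X) (x y : X) : (((-R) Q : SymOp X) : X →L[ℝ] StrongDual ℝ X) x y =
      -(R Q : X →L[ℝ] StrongDual ℝ X) x y := rfl
  refine ⟨-R, ⟨fun Q => ?_, fun P => ?_⟩, fun Q hQ x => ?_⟩
  · have hmem : ((-R) Q, Q) ∈ T.lyapunovGenerator.graph := by
      rw [mem_graph_lyapunovGenerator]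
      -- `T(h)* (R Q) T(h)` is the same integral taken over `(h, ∞)`, so the quotient for `-R Q` is
      -- the average of `T(s)* Q T(s)` over `(0, h)`.
      refine T.tendstoUW_average Q _ fun h hh x y => ?_
      have e1 : ((h⁻¹ • (T.lyapunovSemigroup h ((-R) Q) - (-R) Q) : SymOp X) :
          X →L[ℝ] StrongDual ℝ X) x y =
          h⁻¹ * (-(R Q : X →L[ℝ] StrongDual ℝ X) (T.flow h x) (T.flow h y) -
            -(R Q : X →L[ℝ] StrongDual ℝ X) x y) := by
        rw [T.flow_of_nonneg hh.le]
        rfl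
      have e2 : (R Q : X →L[ℝ] StrongDual ℝ X) (T.flow h x) (T.flow h y) =
          ∫ t in Set.Ioi h, (Q : X →L[ℝ] StrongDual ℝ X) (T.flow t x) (T.flow t y) := by
        have := (measurePreserving_add_right volume h).setIntegral_preimage_emb
          (measurableEmbedding_addRight h)
          (fun t => (Q : X →L[ℝ] StrongDual ℝ X) (T.flow t x) (T.flow t y)) (Set.Ioi h)
        rw [Set.preimage_add_const_Ioi, sub_self] at this
        rw [hR, ← this]
        refine setIntegral_congr_fun measurableSet_Ioi fun t ht => ?_
        simp only [T.flow_add_apply (le_of_lt ht) hh.le]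
      rw [e1, e2, hR, neg_sub_neg, intervalIntegral.integral_Ioi_sub_Ioi (hint Q x y) hh.le]
    obtain ⟨⟨z, hz⟩, rfl, hz2⟩ := (LinearPMap.mem_graph_iff _).1 hmem
    exact ⟨hz, hz2⟩
  · refine SymOp.coe_injective ?_
    ext x y
    have hmem : ((P : SymOp X), T.lyapunovGenerator P) ∈ T.lyapunovGenerator.graph :=
      LinearPMap.mem_graph _ P
    have h1 := intervalIntegral_tendsto_integral_Ioi 0
      (hint (T.lyapunovGenerator P : SymOp X) x y) tendsto_id
    have h2 : Tendsto (fun t => ((P : SymOp X) : X →L[ℝ] StrongDual ℝ X)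
        (T.flow t x) (T.flow t y)) atTop (𝓝 0) := by
      have h3 : Tendsto (fun t : ℝ => Real.exp (-(2 * ω) * t)) atTop (𝓝 0) :=
        Real.tendsto_exp_atBot.comp (tendsto_id.const_mul_atTop_of_neg (by linarith))
      have h4 := h3.const_mul (‖((P : SymOp X) : X →L[ℝ] StrongDual ℝ X)‖ * ‖x‖ * ‖y‖ * M ^ 2)
      rw [mul_zero] at h4
      refine squeeze_zero_norm' ?_ h4
      filter_upwards [eventually_ge_atTop 0] with t ht
      exact T.norm_bilin_flow_le hM _ x y ht
    have h4 := h2.sub_const (((P : SymOp X) : X →L[ℝ] StrongDual ℝ X) x y)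
    -- Let `t → ∞` in `∫₀ᵗ T(s)* (L_A P) T(s) ds = T(t)* P T(t) - P`.
    have h5 := tendsto_nhds_unique (h1.congr' (by
      filter_upwards [eventually_ge_atTop 0] with t ht
      exact T.integral_bilin_flow hmem x y ht)) h4
    rw [hneg, hR, h5]
    simp
  · have : -((-R) Q) = R Q := by rw [neg_apply, neg_neg]
    rw [this, hR]
    exact integral_nonneg fun t => hQ _

variable {V : Type*} [NormedAddCommGroup V] [InnerProductSpace ℝ V]

theorem _root_.LyapunovNegInvertible.lyapunovEqSolvable {T : C0Semigroup X}
    (hT : LyapunovNegInvertible T) (C : X →L[ℝ] V) : LyapunovEqSolvable C T.generator := by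
  obtain ⟨R, ⟨hR, -⟩, hpos⟩ := hT
  let Q : SymOp X := ⟨adjMulSelf C, fun x y => real_inner_comm _ _⟩
  have hQ (x y : X) : (Q : X →L[ℝ] StrongDual ℝ X) x y = inner ℝ (C x) (C y) := rfl
  obtain ⟨hdom, hval⟩ := hR (-Q)
  set P : SymOp X := R (-Q)
  have hP : (P, -Q) ∈ T.lyapunovGenerator.graph :=
    (LinearPMap.mem_graph_iff _).2 ⟨⟨P, hdom⟩, rfl, hval⟩
  -- The two derivatives at `0` give `⟨Px, Ay⟩ = -(Cx, Cy) - ⟨PAx, y⟩`. The right side is bounded in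
  -- `y`, so `Px` is in the domain of `A*`, and its value there is the Lyapunov equation.
  have hmem (x : T.generator.domain) : ((P : X →L[ℝ] StrongDual ℝ X) x,
      -adjMulSelf C x - (P : X →L[ℝ] StrongDual ℝ X) (T.generator x)) ∈
      (banachAdjoint T.generator).graph := by
    rw [mem_graph_banachAdjoint _ T.dense_domain_generator]
    intro y
    have h1 := T.hasDerivWithinAt_bilin_flow P (LinearPMap.mem_graph _ x)
      (LinearPMap.mem_graph _ y) le_rfl
    have h2 := T.hasDerivWithinAt_bilin_flow_of_mem hP x y le_rfl
    have h3 := (uniqueDiffWithinAt_Ioi (0 : ℝ)).eq_deriv _ h1 h2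
    simp only [flow_zero_apply] at h3
    have h4 : ((-Q : SymOp X) : X →L[ℝ] StrongDual ℝ X) x y = -inner ℝ (C x) (C y) := rfl
    rw [h4] at h3
    simp only [sub_apply, neg_apply, adjMulSelf_apply]
    linarith
  refine ⟨P, ?_, fun x => LinearPMap.mem_domain_of_mem_graph (hmem x), fun x => ?_⟩
  · have := hpos Q fun x => by rw [hQ]; exact real_inner_self_nonneg
    rwa [← map_neg] at this
  · obtain ⟨z, hz1, hz2⟩ := (LinearPMap.mem_graph_iff _).1 (hmem x)
    have : z = ⟨(P : X →L[ℝ] StrongDual ℝ X) x, LinearPMap.mem_domain_of_mem_graph (hmem x)⟩ :=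
      Subtype.ext hz1
    rw [← this, hz2]
    exact sub_add_cancel _ _

theorem _root_.LyapunovEqSolvable.integrableOn {T : C0Semigroup X} {C : X →L[ℝ] V}
    (h : LyapunovEqSolvable C T.generator) (x : X) :
    IntegrableOn (fun t => ‖C (T.flow t x)‖ ^ 2) (Set.Ioi 0) := by
  obtain ⟨P, hP, hdom, heq⟩ := h
  have hcont : Continuous fun p : X × ℝ => ‖C (T.flow p.2 p.1)‖ ^ 2 :=
    ((C.continuous.comp (T.continuous_flow_comp continuous_snd continuous_fst)).norm).pow 2
  refine integrableOn_Ioi_zero_of_integral_le (hcont.comp (Continuous.prodMk_right x))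
    (fun _ => sq_nonneg _) (K := (P : X →L[ℝ] StrongDual ℝ X) x x) fun t ht => ?_
  -- For fixed `t` both sides are continuous in `x`, so the bound passes from the dense domain to
  -- `X`.
  have hclosed : IsClosed {x | ∫ s in (0 : ℝ)..t, ‖C (T.flow s x)‖ ^ 2 ≤
      (P : X →L[ℝ] StrongDual ℝ X) x x} :=
    isClosed_le
      (intervalIntegral.continuous_parametric_intervalIntegral_of_continuous' hcont 0 t)
      ((P : X →L[ℝ] StrongDual ℝ X).continuous.clm_apply continuous_id)
  refine hclosed.closure_subset_iff.2 ?_ (T.dense_domain_generator x)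
  intro x hx
  obtain ⟨y, hxy⟩ := LinearPMap.mem_domain_iff.1 hx
  have hlyap (z w : X) (hz : (z, w) ∈ T.generator.graph) :
      (P : X →L[ℝ] StrongDual ℝ X) w z + (P : X →L[ℝ] StrongDual ℝ X) z w = -‖C z‖ ^ 2 := by
    obtain ⟨z, rfl, rfl⟩ := (LinearPMap.mem_graph_iff _).1 hz
    have h1 := (mem_graph_banachAdjoint _ T.dense_domain_generator _ _).1
      (LinearPMap.mem_graph _ ⟨_, hdom z⟩) z
    have h2 := DFunLike.congr_fun (heq z) (z : X)
    simp only [add_apply, neg_apply, adjMulSelf_apply, real_inner_self_eq_norm_sq] at h2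
    rw [← h2, ← h1, add_comm]
  have hftc := intervalIntegral.integral_eq_sub_of_hasDeriv_right_of_le ht
    (T.continuous_bilin_flow P x x).continuousOn
    (f' := fun s => -‖C (T.flow s x)‖ ^ 2)
    (fun s hs => (T.hasDerivWithinAt_bilin_flow P hxy hxy hs.1.le).congr_deriv
      (hlyap _ _ (T.flow_mem_generator_graph hxy hs.1.le)))
    ((hcont.comp (Continuous.prodMk_right x)).neg.intervalIntegrable _ _)
  rw [intervalIntegral.integral_neg, flow_zero_apply] at hftc
  simp only [Set.mem_ofPred_eq]
  linarith [hP (T.flow t x)]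

theorem _root_.L2Detectable.tfae {T : C0Semigroup X} {C : X →L[ℝ] V} (h : L2Detectable C T) :
    List.TFAE [LyapunovEqSolvable C T.generator, T.IsExponentiallyStable,
      LyapunovNegInvertible T] := by
  tfae_have 1 → 2 := fun hP => T.isExponentiallyStable_of_integrableOn_sq fun x =>
    (l2Detectable_iff C T).1 h x (hP.integrableOn x)
  tfae_have 2 → 3 := fun hT => hT.lyapunovNegInvertible
  tfae_have 3 → 1 := fun hT => hT.lyapunovEqSolvable C
  tfae_finish

end C0Semigroup

/-- Stability criterion in terms of the Lyapunov equation. Exponential detectability implies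
detectability in `L²`, and under either of the two the following are equivalent: the Lyapunov
equation has a positive definite solution, the semigroup is exponentially stable, the Lyapunov
generator has a bounded inverse whose negative is positive. -/
theorem theorem1 {X V : Type*} [NormedAddCommGroup X] [NormedSpace ℝ X] [CompleteSpace X]
    [NormedAddCommGroup V] [InnerProductSpace ℝ V] [CompleteSpace V]
    (T : C0Semigroup X) (C : X →L[ℝ] V) :
    (ExponentiallyDetectable C T.generator →
      List.TFAE [LyapunovEqSolvable C T.generator, T.IsExponentiallyStable,
        LyapunovNegInvertible T]) ∧
    (L2Detectable C T →
      List.TFAE [LyapunovEqSolvable C T.generator, T.IsExponentiallyStable,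
        LyapunovNegInvertible T]) ∧
    (ExponentiallyDetectable C T.generator → L2Detectable C T) := by
  exact ⟨fun h => h.l2Detectable.tfae, fun h => h.tfae, fun h => h.l2Detectable⟩
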